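/- **Theorem 6.1 (Tsirelson, Glasner).** Let $(W,H,\mu)$ be an abstract Wiener space: $W$ is a separable real Banach space, $H$ is a separable real Hilbert space continuously, injectively and densely embedded in $W$, and $\mu$ is a Borel measure on $W$ under which every $e\in W^*$ is a $N(0,|e|_H^2)$ random variable, where $W^*\hookrightarrow H^*=H$. Call a measurable map $T:W\to W$ with $T_*\mu=\mu$ *measure preserving*, and call it *invertible* if there is a measure preserving map $S:W\to W$ with $S(Tw)=w$ and $T(Sw)=w$ for $\mu$-almost every $w$. 1. For every invertible measure preserving $T:W\to W$ there is a family $T_\theta:W\to W$, $\theta\in[0,1]$, of invertible measure preserving maps such that $T_0w=w$ and $T_1w=Tw$ for all $w\in W$, and for every $\theta\in[0,1]$ $$E\,|T_\eta w-T_\theta w|_W=\int_W|T_\eta w-T_\theta w|_W\,\mu(dw)\longrightarrow 0\qquad\text{as }\eta\to\theta,\ \eta\in[0,1].$$ 2. Hence the group, under composition, of invertible measure preserving maps of $W$ modulo $\mu$-almost everywhere equality, with the topology given by the metric $d(S,T)=E\,|Sw-Tw|_W$, is connected. -/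

import Mathlib

open MeasureTheory ProbabilityTheory Filter Topology
open scoped ENNReal NNReal unitInterval

/-- `(W, H, μ)` is an abstract Wiener space, the Hilbert space `H` being embedded in the Banach
space `W` by the continuous linear map `i`: the embedding is injective with dense range, and every
continuous linear functional `e` on `W` is, under `μ`, a centred normal variable of variance
`|e|_H ^ 2`. Here `|e|_H` is the norm of `e ∘ i` in `H* = H`. -/
structure IsAbstractWienerSpace {H W : Type*}
    [NormedAddCommGroup H] [InnerProductSpace ℝ H]
    [NormedAddCommGroup W] [NormedSpace ℝ W] [MeasurableSpace W]
    (i : H →L[ℝ] W) (μ : Measure W) : Prop where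
  injective : Function.Injective i
  denseRange : DenseRange i
  map_dual : ∀ e : W →L[ℝ] ℝ, μ.map e = gaussianReal 0 (‖e.comp i‖₊ ^ 2)

/-- An invertible rotation: a measure preserving transformation with a measure preserving
two-sided inverse up to null sets. -/
def IsInvertibleRotation {W : Type*} [MeasurableSpace W] (μ : Measure W) (T : W → W) : Prop :=
  MeasurePreserving T μ μ ∧
    ∃ S : W → W, MeasurePreserving S μ μ ∧ S ∘ T =ᵐ[μ] id ∧ T ∘ S =ᵐ[μ] id

namespace IsInvertibleRotation

variable {W : Type*} [MeasurableSpace W] {μ : Measure W}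

theorem refl_id (μ : Measure W) : IsInvertibleRotation μ (id : W → W) :=
  ⟨MeasurePreserving.id μ, id, MeasurePreserving.id μ, ae_eq_refl _, ae_eq_refl _⟩

theorem comp {T T' : W → W} (h : IsInvertibleRotation μ T) (h' : IsInvertibleRotation μ T') :
    IsInvertibleRotation μ (T ∘ T') := by
  obtain ⟨hT, S, hS, hST, hTS⟩ := h
  obtain ⟨hT', S', hS', hST', hTS'⟩ := h'
  refine ⟨hT.comp hT', S' ∘ S, hS'.comp hS, ?_, ?_⟩
  · filter_upwards [hT'.quasiMeasurePreserving.ae hST, hST'] with w h1 h2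
    simp only [Function.comp_apply, id] at *
    rw [h1, h2]
  · filter_upwards [hS.quasiMeasurePreserving.ae hTS', hTS] with w h1 h2
    simp only [Function.comp_apply, id] at *
    rw [h1, h2]

/-- An inverse, modulo null sets, of an invertible rotation. -/
noncomputable def inv {T : W → W} (h : IsInvertibleRotation μ T) : W → W := h.2.choose

theorem inv_comp {T : W → W} (h : IsInvertibleRotation μ T) : h.inv ∘ T =ᵐ[μ] id :=
  h.2.choose_spec.2.1

theorem comp_inv {T : W → W} (h : IsInvertibleRotation μ T) : T ∘ h.inv =ᵐ[μ] id :=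
  h.2.choose_spec.2.2

theorem isInvertibleRotation_inv {T : W → W} (h : IsInvertibleRotation μ T) :
    IsInvertibleRotation μ h.inv :=
  ⟨h.2.choose_spec.1, T, h.1, h.comp_inv, h.inv_comp⟩

theorem comp_congr {T T' S S' : W → W} (hS : IsInvertibleRotation μ S)
    (hT : T =ᵐ[μ] T') (hSS : S =ᵐ[μ] S') : T ∘ S =ᵐ[μ] T' ∘ S' := by
  filter_upwards [hS.1.quasiMeasurePreserving.ae hT, hSS] with w h1 h2
  simp only [Function.comp_apply]
  rw [h1, h2]

theorem inv_congr {T T' : W → W} (h : IsInvertibleRotation μ T) (h' : IsInvertibleRotation μ T')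
    (hT : T =ᵐ[μ] T') : h.inv =ᵐ[μ] h'.inv := by
  have hi := h.isInvertibleRotation_inv.1
  filter_upwards [hi.quasiMeasurePreserving.ae h'.inv_comp, hi.quasiMeasurePreserving.ae hT,
    h.comp_inv] with w h1 h2 h3
  simp only [Function.comp_apply, id] at *
  rw [← h2, h3] at h1
  exact h1.symm

end IsInvertibleRotation

/-- Two invertible rotations are identified when they agree almost everywhere. -/
def invertibleRotationSetoid {W : Type*} [MeasurableSpace W] (μ : Measure W) :
    Setoid {T : W → W // IsInvertibleRotation μ T} where
  r S T := S.1 =ᵐ[μ] T.1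
  iseqv := ⟨fun _ => ae_eq_refl _, fun h => h.symm, fun h h' => h.trans h'⟩

/-- The set of invertible rotations modulo almost everywhere equality. -/
def RotationGroup {W : Type*} [MeasurableSpace W] (μ : Measure W) : Type _ :=
  Quotient (invertibleRotationSetoid μ)

namespace RotationGroup

/-- The multiplication is composition of maps. -/
noncomputable instance instGroup {W : Type*} [MeasurableSpace W] (μ : Measure W) :
    Group (RotationGroup μ) where
  mul := Quotient.map₂ (fun S T => ⟨S.1 ∘ T.1, S.2.comp T.2⟩)
    (fun S S' h T T' h' =>
      IsInvertibleRotation.comp_congr (T := S.1) (T' := S'.1) (S' := T'.1) T.2 h h')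
  one := Quotient.mk _ ⟨id, IsInvertibleRotation.refl_id μ⟩
  inv := Quotient.map (fun T => ⟨T.2.inv, T.2.isInvertibleRotation_inv⟩)
    (fun S T h => S.2.inv_congr T.2 h)
  mul_assoc := by
    rintro ⟨a⟩ ⟨b⟩ ⟨c⟩
    rfl
  one_mul := by
    rintro ⟨a⟩
    rfl
  mul_one := by
    rintro ⟨a⟩
    rfl
  inv_mul_cancel := by
    rintro ⟨a⟩
    exact Quotient.sound a.2.inv_comp

/-- The distance `E |S w - T w|_W`; it induces the topology of the group. -/
noncomputable instance instEMetricSpace {W : Type*} [NormedAddCommGroup W] [MeasurableSpace W]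
    [BorelSpace W] [SecondCountableTopology W] (μ : Measure W) :
    EMetricSpace (RotationGroup μ) where
  edist := Quotient.lift₂ (fun S T => ∫⁻ w, ‖S.1 w - T.1 w‖ₑ ∂μ) (by
    intro S T S' T' h h'
    refine lintegral_congr_ae ?_
    have h : S.1 =ᵐ[μ] S'.1 := h
    have h' : T.1 =ᵐ[μ] T'.1 := h'
    filter_upwards [h, h'] with w h1 h2
    rw [h1, h2])
  edist_self := by
    rintro ⟨a⟩
    change ∫⁻ w, ‖a.1 w - a.1 w‖ₑ ∂μ = 0
    simp
  edist_comm := by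
    rintro ⟨a⟩ ⟨b⟩
    refine lintegral_congr fun w => ?_
    exact enorm_sub_rev _ _
  edist_triangle := by
    rintro ⟨a⟩ ⟨b⟩ ⟨c⟩
    have hm : Measurable fun w => ‖a.1 w - b.1 w‖ₑ :=
      (a.2.1.measurable.sub b.2.1.measurable).enorm
    change ∫⁻ w, ‖a.1 w - c.1 w‖ₑ ∂μ ≤
      ∫⁻ w, ‖a.1 w - b.1 w‖ₑ ∂μ + ∫⁻ w, ‖b.1 w - c.1 w‖ₑ ∂μ
    rw [← lintegral_add_left hm]
    refine lintegral_mono fun w => ?_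
    rw [← sub_add_sub_cancel (a.1 w) (b.1 w) (c.1 w)]
    exact enorm_add_le _ _
  eq_of_edist_eq_zero := by
    rintro ⟨a⟩ ⟨b⟩ h
    have hm : Measurable fun w => ‖a.1 w - b.1 w‖ₑ :=
      (a.2.1.measurable.sub b.2.1.measurable).enorm
    change ∫⁻ w, ‖a.1 w - b.1 w‖ₑ ∂μ = 0 at h
    rw [lintegral_eq_zero_iff hm] at h
    refine Quotient.sound ?_
    change a.1 =ᵐ[μ] b.1
    filter_upwards [h] with w hw
    simpa [sub_eq_zero] using hw

end RotationGroup

/-!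
Inducing an invertible rotation `T` on a set `A` (following the orbit of a point of `A` up to its
first return to `A`, and fixing the points outside `A`) gives again an invertible rotation, by
Poincaré recurrence. Enlarging `A` to `B` changes the induced map only on `B \ A` and on the points
that are sent into `B \ A`, hence on a set of measure at most `2 * μ (B \ A)`. So the maps induced
on a family of sets which grows continuously in measure from `∅` to `{x | T x ≠ x}` form a path from
the identity to `T`. Such a family exists because the points moved by `T` carry no atom, as soon as
no two atoms of `μ` have the same mass: a Gaussian measure has no atom or is a Dirac measure. The
path is continuous in `L¹` because the maps of an integrable measure preserving family are uniformly
integrable.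
-/

section ReturnTime

variable {X : Type*} {T S : X → X} {A B : Set X} {x : X} {n : ℕ}

/-- The first time `n ≠ 0` at which the orbit of `x ∈ A` under `T` is back in `A`. It is `0` if `x`
never returns to `A`, and also if `x ∉ A`. -/
noncomputable def returnTime (T : X → X) (A : Set X) (x : X) : ℕ :=
  sInf {n | x ∈ A ∧ n ≠ 0 ∧ T^[n] x ∈ A}

/-- The transformation induced by `T` on `A`: a point of `A` is sent to the first point of its
orbit that lies in `A`. Since `returnTime` vanishes there, the points outside `A` and those which
never return to `A` are fixed. -/
noncomputable def inducedMap (T : X → X) (A : Set X) (x : X) : X :=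
  T^[returnTime T A x] x

theorem returnTime_eq_iff (hn : n ≠ 0) :
    returnTime T A x = n ↔ x ∈ A ∧ T^[n] x ∈ A ∧ ∀ k < n, k ≠ 0 → T^[k] x ∉ A := by
  refine ⟨?_, fun ⟨hx, hnA, hmin⟩ => ?_⟩
  · rintro rfl
    obtain ⟨hx, -, hA⟩ := Nat.sInf_mem (Nat.nonempty_of_pos_sInf (Nat.pos_of_ne_zero hn))
    exact ⟨hx, hA, fun k hk hk0 hkA => Nat.notMem_of_lt_sInf hk ⟨hx, hk0, hkA⟩⟩
  · refine le_antisymm (Nat.sInf_le ⟨hx, hn, hnA⟩) (le_csInf ⟨n, hx, hn, hnA⟩ ?_)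
    rintro k ⟨-, hk0, hkA⟩
    exact not_lt.1 fun hk => hmin k hk hk0 hkA

theorem returnTime_eq_zero_iff :
    returnTime T A x = 0 ↔ x ∈ A → ∀ n ≠ 0, T^[n] x ∉ A := by
  simp only [returnTime, Nat.sInf_eq_zero, Set.eq_empty_iff_forall_notMem, Set.mem_ofPred_eq,
    ne_eq, not_true_eq_false, false_and, and_false, false_or, not_and]
  exact ⟨fun h hx n => h n hx, fun h n hx => h hx n⟩

theorem returnTime_of_notMem (hx : x ∉ A) : returnTime T A x = 0 :=
  returnTime_eq_zero_iff.2 fun h => absurd h hx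

theorem inducedMap_of_notMem (hx : x ∉ A) : inducedMap T A x = x := by
  rw [inducedMap, returnTime_of_notMem hx, Function.iterate_zero_apply]

theorem inducedMap_mem (hx : x ∈ A) : inducedMap T A x ∈ A := by
  by_cases h0 : returnTime T A x = 0
  · rwa [inducedMap, h0, Function.iterate_zero_apply]
  · exact ((returnTime_eq_iff h0).1 rfl).2.1

theorem inducedMap_empty (T : X → X) : inducedMap T ∅ = id :=
  funext fun x => inducedMap_of_notMem (Set.notMem_empty x)

theorem inducedMap_eq_of_subset (hAB : A ⊆ B) (hx : x ∈ A) (hxA : inducedMap T B x ∈ A) :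
    inducedMap T A x = inducedMap T B x := by
  suffices returnTime T A x = returnTime T B x by rw [inducedMap, inducedMap, this]
  by_cases h0 : returnTime T B x = 0
  · rw [h0, returnTime_eq_zero_iff]
    exact fun _ n hn hnA => returnTime_eq_zero_iff.1 h0 (hAB hx) n hn (hAB hnA)
  · obtain ⟨-, -, hmin⟩ := (returnTime_eq_iff h0).1 rfl
    exact (returnTime_eq_iff h0).2 ⟨hx, hxA, fun k hk hk0 hkA => hmin k hk hk0 (hAB hkA)⟩

theorem setOf_inducedMap_ne_subset (T : X → X) (hAB : A ⊆ B) :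
    {x | inducedMap T A x ≠ inducedMap T B x} ⊆ inducedMap T B ⁻¹' (B \ A) ∪ B \ A := by
  intro x hne
  by_contra! hx
  simp only [Set.mem_union, Set.mem_preimage, Set.mem_sdiff, not_or, not_and_not_right] at hx
  refine hne ?_
  by_cases hxB : x ∈ B
  · exact inducedMap_eq_of_subset hAB (hx.2 hxB) (hx.1 (inducedMap_mem hxB))
  · rw [inducedMap_of_notMem hxB, inducedMap_of_notMem fun hxA => hxB (hAB hxA)]

/-- The orbit segment of `x` up to its first return meets `A` exactly in its endpoints, which
remains true when `S` runs it backwards. -/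
theorem returnTime_inducedMap (hST : ∀ k n, S^[k] (T^[k + n] x) = T^[n] x)
    (hrec : x ∈ A → ∃ n ≠ 0, T^[n] x ∈ A) :
    returnTime S A (inducedMap T A x) = returnTime T A x := by
  by_cases h0 : returnTime T A x = 0
  · have hxA : x ∉ A := fun hx =>
      let ⟨n, hn, hnA⟩ := hrec hx
      returnTime_eq_zero_iff.1 h0 hx n hn hnA
    rw [inducedMap_of_notMem hxA, returnTime_of_notMem hxA, h0]
  · obtain ⟨hx, hτ, hmin⟩ := (returnTime_eq_iff h0).1 rfl
    have hback : ∀ k ≤ returnTime T A x,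
        S^[k] (inducedMap T A x) = T^[returnTime T A x - k] x := fun k hk => by
      rw [← hST k, Nat.add_sub_cancel' hk, inducedMap]
    refine (returnTime_eq_iff h0).2 ⟨hτ, ?_, fun k hk hk0 => ?_⟩
    · rwa [hback _ le_rfl, Nat.sub_self]
    · rw [hback k hk.le]
      exact hmin _ (by lia) (by lia)

end ReturnTime

section MeasurableReturnTime

variable {X : Type*} [MeasurableSpace X] {T : X → X}

theorem measurable_returnTime {A : Set X} (hT : Measurable T) (hA : MeasurableSet A) :
    Measurable (returnTime T A) := by
  have hTA : ∀ n, MeasurableSet (T^[n] ⁻¹' A) := fun n => hT.iterate n hA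
  refine measurable_to_countable' fun n => ?_
  by_cases hn : n = 0
  · have : returnTime T A ⁻¹' {n} = Aᶜ ∪ ⋂ (k) (_ : k ≠ 0), (T^[k] ⁻¹' A)ᶜ := by
      ext x
      simp [hn, returnTime_eq_zero_iff, imp_iff_not_or]
    rw [this]
    exact hA.compl.union (.iInter fun k => .iInter fun _ => (hTA k).compl)
  · have : returnTime T A ⁻¹' {n} =
        A ∩ (T^[n] ⁻¹' A ∩ ⋂ (k) (_ : k < n) (_ : k ≠ 0), (T^[k] ⁻¹' A)ᶜ) := by
      ext x
      simp [returnTime_eq_iff hn]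
    rw [this]
    exact hA.inter ((hTA n).inter
      (.iInter fun k => .iInter fun _ => .iInter fun _ => (hTA k).compl))

theorem measurable_iterate_time (hT : Measurable T) {τ : X → ℕ} (hτ : Measurable τ) :
    Measurable fun x => T^[τ x] x :=
  (measurable_from_prod_countable_right hT.iterate : Measurable fun p : ℕ × X => T^[p.1] p.2).comp
    (hτ.prodMk measurable_id)

end MeasurableReturnTime

section InducedRotation

variable {X : Type*} [MeasurableSpace X] {μ : Measure X} {T S : X → X} {A B : Set X}

theorem tsum_measure_inter_preimage_singleton {ι : Type*} [Countable ι] [MeasurableSpace ι]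
    [MeasurableSingletonClass ι] (hA : MeasurableSet A) {τ : X → ι} (hτ : Measurable τ) :
    ∑' i, μ (A ∩ τ ⁻¹' {i}) = μ A := by
  have hdisj : Pairwise (Function.onFun Disjoint fun i => A ∩ τ ⁻¹' {i}) := fun i j hij =>
    ((Set.disjoint_singleton.2 hij).preimage τ).mono Set.inter_subset_right Set.inter_subset_right
  rw [← measure_iUnion hdisj fun i => hA.inter (hτ (measurableSet_singleton i)),
    ← Set.inter_iUnion, ← Set.preimage_iUnion, Set.iUnion_of_singleton, Set.preimage_univ,
    Set.inter_univ]

/-- Since `ρ` recovers the number of steps from the endpoint, the images of the level sets of `τ` do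
not overlap. Hence no set gains mass under the push-forward, and the total mass is unchanged. -/
theorem measurePreserving_iterate_time [IsFiniteMeasure μ] (hT : MeasurePreserving T μ μ)
    {τ ρ : X → ℕ} (hτ : Measurable τ) (hρ : Measurable ρ)
    (hρτ : ∀ᵐ x ∂μ, ρ (T^[τ x] x) = τ x) : MeasurePreserving (fun x => T^[τ x] x) μ μ := by
  set R : X → X := fun x => T^[τ x] x
  have hR : Measurable R := measurable_iterate_time hT.measurable hτ
  have hle : μ.map R ≤ μ := Measure.le_iff.2 fun B hB => by
    have hsub : ∀ n, (R ⁻¹' B ∩ τ ⁻¹' {n} : Set X) ≤ᵐ[μ] T^[n] ⁻¹' (B ∩ ρ ⁻¹' {n}) := fun n => by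
      filter_upwards [hρτ] with x hx
      rintro ⟨hxB, rfl⟩
      exact ⟨hxB, hx⟩
    calc μ.map R B
        = ∑' n, μ (R ⁻¹' B ∩ τ ⁻¹' {n}) := by
          rw [Measure.map_apply hR hB, tsum_measure_inter_preimage_singleton (hR hB) hτ]
      _ ≤ ∑' n, μ (T^[n] ⁻¹' (B ∩ ρ ⁻¹' {n})) :=
          ENNReal.tsum_le_tsum fun n => measure_mono_ae (hsub n)
      _ = ∑' n, μ (B ∩ ρ ⁻¹' {n}) := tsum_congr fun n =>
          (hT.iterate n).measure_preimage
            (hB.inter (hρ (measurableSet_singleton n))).nullMeasurableSet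
      _ = μ B := tsum_measure_inter_preimage_singleton hB hρ
  refine ⟨hR, Measure.eq_of_le_of_measure_univ_eq hle ?_⟩
  rw [Measure.map_apply hR .univ, Set.preimage_univ]

theorem ae_iterate_iterate_add (hT : MeasurePreserving T μ μ) (hST : S ∘ T =ᵐ[μ] id) :
    ∀ᵐ x ∂μ, ∀ k n, S^[k] (T^[k + n] x) = T^[n] x := by
  have hstep : ∀ᵐ x ∂μ, ∀ n, S (T^[n + 1] x) = T^[n] x := ae_all_iff.2 fun n => by
    simpa only [Function.iterate_succ_apply', Function.comp_apply, id] using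
      (hT.iterate n).quasiMeasurePreserving.ae hST
  filter_upwards [hstep] with x hx k
  induction k with
  | zero => simp
  | succ k ih =>
    intro n
    rw [Function.iterate_succ_apply, Nat.add_right_comm, hx, ih]

theorem ae_mem_imp_exists_iterate_mem [IsFiniteMeasure μ] (hT : MeasurePreserving T μ μ)
    (hA : MeasurableSet A) : ∀ᵐ x ∂μ, x ∈ A → ∃ n ≠ 0, T^[n] x ∈ A := by
  filter_upwards [hT.conservative.ae_mem_imp_frequently_image_mem hA.nullMeasurableSet]
    with x hx hxA
  obtain ⟨n, hnA, hn⟩ := ((hx hxA).and_eventually (eventually_ne_atTop 0)).exists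
  exact ⟨n, hn, hnA⟩

theorem ae_returnTime_inducedMap [IsFiniteMeasure μ] (hT : MeasurePreserving T μ μ)
    (hST : S ∘ T =ᵐ[μ] id) (hA : MeasurableSet A) :
    ∀ᵐ x ∂μ, returnTime S A (inducedMap T A x) = returnTime T A x := by
  filter_upwards [ae_iterate_iterate_add hT hST, ae_mem_imp_exists_iterate_mem hT hA]
    with x hx hrec
  exact returnTime_inducedMap hx hrec

theorem measurePreserving_inducedMap [IsFiniteMeasure μ] (hT : MeasurePreserving T μ μ)
    (hS : Measurable S) (hST : S ∘ T =ᵐ[μ] id) (hA : MeasurableSet A) :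
    MeasurePreserving (inducedMap T A) μ μ :=
  measurePreserving_iterate_time hT (measurable_returnTime hT.measurable hA)
    (measurable_returnTime hS hA) (ae_returnTime_inducedMap hT hST hA)

theorem inducedMap_comp_inducedMap [IsFiniteMeasure μ] (hT : MeasurePreserving T μ μ)
    (hST : S ∘ T =ᵐ[μ] id) (hA : MeasurableSet A) :
    inducedMap S A ∘ inducedMap T A =ᵐ[μ] id := by
  filter_upwards [ae_iterate_iterate_add hT hST, ae_returnTime_inducedMap hT hST hA] with x hx hτ
  rw [Function.comp_apply, inducedMap, hτ]
  exact hx (returnTime T A x) 0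

namespace IsInvertibleRotation

theorem isInvertibleRotation_inducedMap [IsFiniteMeasure μ] (hT : IsInvertibleRotation μ T)
    (hA : MeasurableSet A) : IsInvertibleRotation μ (inducedMap T A) := by
  obtain ⟨hT, S, hS, hST, hTS⟩ := hT
  exact ⟨measurePreserving_inducedMap hT hS.measurable hST hA, inducedMap S A,
    measurePreserving_inducedMap hS hT.measurable hTS hA,
    inducedMap_comp_inducedMap hT hST hA, inducedMap_comp_inducedMap hS hTS hA⟩

theorem measure_inducedMap_ne_le_of_subset [IsFiniteMeasure μ] (hT : IsInvertibleRotation μ T)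
    (hA : MeasurableSet A) (hB : MeasurableSet B) (hAB : A ⊆ B) :
    μ {x | inducedMap T A x ≠ inducedMap T B x} ≤ 2 * μ (B \ A) :=
  calc μ {x | inducedMap T A x ≠ inducedMap T B x}
      ≤ μ (inducedMap T B ⁻¹' (B \ A) ∪ B \ A) := measure_mono (setOf_inducedMap_ne_subset T hAB)
    _ ≤ μ (inducedMap T B ⁻¹' (B \ A)) + μ (B \ A) := measure_union_le _ _
    _ = 2 * μ (B \ A) := by
      rw [(hT.isInvertibleRotation_inducedMap hB).1.measure_preimage (hB.diff hA).nullMeasurableSet,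
        two_mul]

theorem measure_inducedMap_ne_le [IsFiniteMeasure μ] (hT : IsInvertibleRotation μ T)
    (hA : MeasurableSet A) (hB : MeasurableSet B) :
    μ {x | inducedMap T A x ≠ inducedMap T B x} ≤ 2 * μ (symmDiff A B) := by
  have hsub : {x | inducedMap T A x ≠ inducedMap T B x} ⊆
      {x | inducedMap T (A ∩ B) x ≠ inducedMap T A x} ∪
        {x | inducedMap T (A ∩ B) x ≠ inducedMap T B x} := fun x hne => by
    by_contra! hx
    simp only [Set.mem_union, Set.mem_ofPred_eq, not_or, not_not] at hx
    exact hne (hx.1.symm.trans hx.2)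
  calc μ {x | inducedMap T A x ≠ inducedMap T B x}
      ≤ μ {x | inducedMap T (A ∩ B) x ≠ inducedMap T A x} +
          μ {x | inducedMap T (A ∩ B) x ≠ inducedMap T B x} :=
      (measure_mono hsub).trans (measure_union_le _ _)
    _ ≤ 2 * μ (A \ (A ∩ B)) + 2 * μ (B \ (A ∩ B)) :=
      add_le_add
        (hT.measure_inducedMap_ne_le_of_subset (hA.inter hB) hA Set.inter_subset_left)
        (hT.measure_inducedMap_ne_le_of_subset (hA.inter hB) hB Set.inter_subset_right)
    _ = 2 * μ (symmDiff A B) := by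
      rw [Set.sdiff_inter_self_eq_sdiff, Set.sdiff_self_inter, measure_symmDiff_eq
        hA.nullMeasurableSet hB.nullMeasurableSet, mul_add]

theorem inducedMap_setOf_ne_ae_eq [IsFiniteMeasure μ] (hT : IsInvertibleRotation μ T)
    (hm : MeasurableSet {x | T x ≠ x}) : inducedMap T {x | T x ≠ x} =ᵐ[μ] T := by
  filter_upwards [ae_mem_imp_exists_iterate_mem hT.1 hm] with x hrec
  by_cases hx : T x = x
  · rw [inducedMap_of_notMem (by simpa using hx), hx]
  · obtain ⟨n, hn, hnx⟩ := hrec hx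
    have hTx : T (T x) ≠ T x := fun hfix => hnx <| by
      obtain ⟨m, rfl⟩ := Nat.exists_eq_succ_of_ne_zero hn
      rw [Function.iterate_succ_apply, Function.iterate_fixed hfix, hfix]
    have hτ : returnTime T {x | T x ≠ x} x = 1 :=
      (returnTime_eq_iff one_ne_zero).2 ⟨hx, hTx, by lia⟩
    rw [inducedMap, hτ, Function.iterate_one]

theorem measure_singleton_eq_zero [MeasurableSingletonClass X] (hT : IsInvertibleRotation μ T)
    (hμ : Set.InjOn (fun x => μ {x}) {x | μ {x} ≠ 0}) {x : X} (hx : T x ≠ x) : μ {x} = 0 := by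
  by_contra h0
  obtain ⟨hT, S, hS, hST, -⟩ := hT
  have hSTx : S (T x) = x := by
    by_contra hne
    exact h0 (measure_mono_null (Set.singleton_subset_iff.2 hne) hST)
  have hle : μ {x} ≤ μ {T x} := by
    rw [← hT.measure_preimage (nullMeasurableSet_singleton (T x))]
    exact measure_mono (Set.singleton_subset_iff.2 rfl)
  have hge : μ {T x} ≤ μ {x} := by
    rw [← hS.measure_preimage (nullMeasurableSet_singleton x)]
    exact measure_mono (Set.singleton_subset_iff.2 hSTx)
  exact hx (hμ (ne_bot_of_le_ne_bot h0 hle) h0 (hge.antisymm hle))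

end IsInvertibleRotation

end InducedRotation

section Sublevel

theorem exists_measurable_injective_mem_Ioo (X : Type*) [MeasurableSpace X]
    [MeasurableSpace.CountablySeparated X] :
    ∃ g : X → ℝ, Measurable g ∧ Function.Injective g ∧ ∀ x, g x ∈ Set.Ioo 0 1 := by
  obtain ⟨f, hf, hf_inj⟩ := MeasurableSpace.measurable_injection_nat_bool_of_countablySeparated X
  have he := measurableEmbedding_embeddingReal (ℕ → Bool)
  exact ⟨fun x => Real.sigmoid (embeddingReal _ (f x)),
    Real.sigmoid_monotone.measurable.comp (he.measurable.comp hf),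
    Real.sigmoid_injective.comp (he.injective.comp hf_inj),
    fun x => ⟨Real.sigmoid_pos _, Real.sigmoid_lt_one _⟩⟩

variable {X : Type*} [MeasurableSpace X]

theorem tendsto_measure_preimage_uIcc {μ : Measure X} [IsFiniteMeasure μ] {g : X → ℝ}
    (hg : Measurable g) (c : ℝ) :
    Tendsto (fun t => μ (g ⁻¹' Set.uIcc c t)) (𝓝 c) (𝓝 (μ (g ⁻¹' {c}))) := by
  have hdist : Tendsto (fun t : ℝ => |t - c|) (𝓝 c) (𝓝[≥] 0) := by
    refine tendsto_nhdsWithin_iff.2 ⟨?_, .of_forall fun t => abs_nonneg (t - c)⟩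
    exact (by fun_prop : Continuous fun t : ℝ => |t - c|).tendsto' c 0 (by simp)
  have hlim := (tendsto_measure_Icc_nhdsWithin_right (μ.map g) c).comp hdist
  rw [Measure.map_apply hg (measurableSet_singleton c)] at hlim
  refine tendsto_of_tendsto_of_tendsto_of_le_of_le tendsto_const_nhds hlim
    (fun t => measure_mono (Set.preimage_mono (by simp))) fun t => ?_
  rw [Function.comp_apply, Measure.map_apply hg measurableSet_Icc]
  refine measure_mono (Set.preimage_mono fun y hy => ?_)
  have := Set.abs_sub_left_of_mem_uIcc hy
  rw [← Real.closedBall_eq_Icc, Metric.mem_closedBall, Real.dist_eq]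
  exact this

theorem exists_continuous_measurableSet_of_measure_singleton_eq_zero
    [MeasurableSpace.CountablySeparated X] {μ : Measure X} [IsFiniteMeasure μ] {M : Set X}
    (hM : MeasurableSet M) (hμ : ∀ x ∈ M, μ {x} = 0) :
    ∃ A : I → Set X, (∀ θ, MeasurableSet (A θ)) ∧ A 0 = ∅ ∧ A 1 = M ∧
      ∀ θ, Tendsto (fun η => μ (symmDiff (A η) (A θ))) (𝓝 θ) (𝓝 0) := by
  obtain ⟨g, hg, hg_inj, hg_mem⟩ := exists_measurable_injective_mem_Ioo X
  have hfiber : ∀ c, μ.restrict M (g ⁻¹' {c}) = 0 := fun c => by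
    rw [Measure.restrict_apply (hg (measurableSet_singleton c))]
    have hsub : (g ⁻¹' {c} ∩ M).Subsingleton :=
      fun x hx y hy => hg_inj (hx.1.trans hy.1.symm)
    obtain h | ⟨x, h⟩ := hsub.eq_empty_or_singleton
    · rw [h, measure_empty]
    · have hx : x ∈ g ⁻¹' {c} ∩ M := h ▸ Set.mem_singleton x
      rw [h, hμ x hx.2]
  refine ⟨fun θ => M ∩ {x | g x < θ}, fun θ => hM.inter (measurableSet_lt hg measurable_const),
    ?_, ?_, fun θ => ?_⟩
  · exact Set.eq_empty_of_forall_notMem fun x hx => (hg_mem x).1.not_gt hx.2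
  · exact Set.inter_eq_left.2 fun x _ => (hg_mem x).2
  have hsub : ∀ η : I, symmDiff (M ∩ {x | g x < η}) (M ∩ {x | g x < θ}) ⊆
      g ⁻¹' Set.uIcc (θ : ℝ) η ∩ M := by
    rintro η x (⟨⟨hxM, hlt⟩, hx⟩ | ⟨⟨hxM, hlt⟩, hx⟩)
    · have hle : (θ : ℝ) ≤ g x := not_lt.1 fun h => hx ⟨hxM, h⟩
      exact ⟨Set.mem_uIcc.2 (.inl ⟨hle, hlt.le⟩), hxM⟩
    · have hle : (η : ℝ) ≤ g x := not_lt.1 fun h => hx ⟨hxM, h⟩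
      exact ⟨Set.mem_uIcc.2 (.inr ⟨hle, hlt.le⟩), hxM⟩
  have hlim := tendsto_measure_preimage_uIcc (μ := μ.restrict M) hg (θ : ℝ)
  rw [hfiber] at hlim
  refine tendsto_of_tendsto_of_tendsto_of_le_of_le tendsto_const_nhds
    (hlim.comp continuous_subtype_val.continuousAt) (fun _ => zero_le) fun η => ?_
  rw [Function.comp_apply, Measure.restrict_apply (hg measurableSet_uIcc)]
  exact measure_mono (hsub η)

end Sublevel

section UniformDistance

theorem unifIntegrable_of_measurePreserving {ι X E : Type*} [MeasurableSpace X]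
    [NormedAddCommGroup E] [MeasurableSpace E] [BorelSpace E] {ν : Measure X} [IsFiniteMeasure ν]
    {μ : Measure E} (hμ : Integrable id μ) {R : ι → X → E} (hR : ∀ i, MeasurePreserving (R i) ν μ) :
    UnifIntegrable R 1 ν := by
  obtain hι | ⟨⟨j⟩⟩ := isEmpty_or_nonempty ι
  · exact fun _ _ => ⟨1, one_pos, isEmptyElim⟩
  have hj : MemLp (R j) 1 ν := memLp_one_iff_integrable.2 ((hR j).integrable_comp_of_integrable hμ)
  have hident : ∀ i, IdentDistrib (R i) (R j) ν ν := fun i =>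
    ⟨(hR i).aemeasurable, (hR j).aemeasurable, by rw [(hR i).map_eq, (hR j).map_eq]⟩
  exact
    (MemLp.uniformIntegrable_of_identDistrib le_rfl ENNReal.one_ne_top hj hident).unifIntegrable

theorem tendsto_lintegral_enorm_sub_of_tendsto_measure_ne {ι X E : Type*} [MeasurableSpace X]
    [NormedAddCommGroup E] [MeasurableSpace E] [BorelSpace E] [SecondCountableTopology E]
    {ν : Measure X} [IsFiniteMeasure ν] {μ : Measure E} (hμ : Integrable id μ) {l : Filter ι}
    {R : ι → X → E} {R₀ : X → E} (hR : ∀ i, MeasurePreserving (R i) ν μ)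
    (hR₀ : MeasurePreserving R₀ ν μ)
    (hne : Tendsto (fun i => ν {x | R i x ≠ R₀ x}) l (𝓝 0)) :
    Tendsto (fun i => ∫⁻ x, ‖R i x - R₀ x‖ₑ ∂ν) l (𝓝 0) := by
  have hsub : UnifIntegrable (fun i => R i - R₀) 1 ν :=
    (unifIntegrable_of_measurePreserving hμ hR).sub
      (unifIntegrable_of_measurePreserving hμ fun _ => hR₀) le_rfl
      (fun i => (hR i).measurable.aestronglyMeasurable)
      fun _ => hR₀.measurable.aestronglyMeasurable
  refine ENNReal.tendsto_nhds_zero.2 fun ε hε => ?_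
  obtain ⟨r, -, hr, hrε⟩ := ENNReal.lt_iff_exists_real_btwn.1 hε
  obtain ⟨δ, hδ, hsmall⟩ := hsub (ENNReal.ofReal_pos.1 hr)
  filter_upwards [hne.eventually_le_const (ENNReal.ofReal_pos.2 hδ)] with i hi
  have hm : MeasurableSet {x | R i x ≠ R₀ x} :=
    (measurableSet_eq_fun (hR i).measurable hR₀.measurable).compl
  have hind : {x | R i x ≠ R₀ x}.indicator (R i - R₀) = R i - R₀ :=
    Set.indicator_eq_self.2 fun x hx heq => hx (by rw [Pi.sub_apply, heq, sub_self])
  calc ∫⁻ x, ‖R i x - R₀ x‖ₑ ∂ν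
      = eLpNorm ({x | R i x ≠ R₀ x}.indicator (R i - R₀)) 1 ν := by
        rw [hind, eLpNorm_one_eq_lintegral_enorm]; rfl
    _ ≤ ENNReal.ofReal r := hsmall i _ hm hi
    _ ≤ ε := hrε.le

end UniformDistance

namespace RotationGroup

section Mk

variable {X : Type*} [MeasurableSpace X] {μ : Measure X} {S T : X → X}

/-- The class modulo almost everywhere equality of an invertible rotation. -/
def mk (T : X → X) (hT : IsInvertibleRotation μ T) : RotationGroup μ :=
  Quotient.mk _ ⟨T, hT⟩

theorem mk_eq_mk_iff (hS : IsInvertibleRotation μ S) (hT : IsInvertibleRotation μ T) :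
    mk S hS = mk T hT ↔ S =ᵐ[μ] T :=
  Quotient.eq

theorem exists_mk_eq (t : RotationGroup μ) : ∃ T, ∃ hT : IsInvertibleRotation μ T, mk T hT = t := by
  obtain ⟨⟨T, hT⟩, rfl⟩ := Quotient.exists_rep t
  exact ⟨T, hT, rfl⟩

end Mk

variable {W : Type*} [NormedAddCommGroup W] [MeasurableSpace W] [BorelSpace W]
  [SecondCountableTopology W] {μ : Measure W} {S T : W → W}

theorem edist_mk_mk (hS : IsInvertibleRotation μ S) (hT : IsInvertibleRotation μ T) :
    edist (mk S hS) (mk T hT) = ∫⁻ w, ‖S w - T w‖ₑ ∂μ :=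
  rfl

theorem continuous_mk_inducedMap [IsFiniteMeasure μ] (hμ : Integrable id μ)
    (hT : IsInvertibleRotation μ T) {ι : Type*} [TopologicalSpace ι] {A : ι → Set W}
    (hA : ∀ i, MeasurableSet (A i))
    (hA_cont : ∀ i, Tendsto (fun j => μ (symmDiff (A j) (A i))) (𝓝 i) (𝓝 0)) :
    Continuous fun i => mk (inducedMap T (A i)) (hT.isInvertibleRotation_inducedMap (hA i)) := by
  refine continuous_iff_continuousAt.2 fun i => tendsto_iff_edist_tendsto_0.2 ?_
  simp only [edist_mk_mk]
  refine tendsto_lintegral_enorm_sub_of_tendsto_measure_ne hμ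
    (fun j => (hT.isInvertibleRotation_inducedMap (hA j)).1)
    (hT.isInvertibleRotation_inducedMap (hA i)).1 ?_
  have hlim := ENNReal.Tendsto.const_mul (hA_cont i) (.inr (ENNReal.ofNat_ne_top (n := 2)))
  rw [mul_zero] at hlim
  exact tendsto_of_tendsto_of_tendsto_of_le_of_le tendsto_const_nhds hlim (fun _ => zero_le)
    fun j => hT.measure_inducedMap_ne_le (hA j) (hA i)

theorem joined_one_mk [IsFiniteMeasure μ] (hμ : Integrable id μ)
    (hatom : Set.InjOn (fun w => μ {w}) {w | μ {w} ≠ 0}) (hT : IsInvertibleRotation μ T) :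
    Joined 1 (mk T hT) := by
  have hM : MeasurableSet {w | T w ≠ w} :=
    (measurableSet_eq_fun hT.1.measurable measurable_id).compl
  obtain ⟨A, hA, hA0, hA1, hA_cont⟩ :=
    exists_continuous_measurableSet_of_measure_singleton_eq_zero hM
      fun w hw => hT.measure_singleton_eq_zero hatom hw
  refine ⟨⟨⟨_, continuous_mk_inducedMap hμ hT hA hA_cont⟩, ?_, ?_⟩⟩
  · exact (mk_eq_mk_iff _ (.refl_id μ)).2 (by rw [hA0, inducedMap_empty])
  · exact (mk_eq_mk_iff _ hT).2 (by rw [hA1]; exact hT.inducedMap_setOf_ne_ae_eq hM)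

theorem pathConnectedSpace [IsFiniteMeasure μ] (hμ : Integrable id μ)
    (hatom : Set.InjOn (fun w => μ {w}) {w | μ {w} ≠ 0}) :
    PathConnectedSpace (RotationGroup μ) := by
  have hjoined : ∀ t : RotationGroup μ, Joined 1 t := fun t => by
    obtain ⟨T, hT, rfl⟩ := exists_mk_eq t
    exact joined_one_mk hμ hatom hT
  exact ⟨⟨1⟩, fun s t => (hjoined s).symm.trans (hjoined t)⟩

theorem exists_representatives_of_path {hS : IsInvertibleRotation μ S}
    {hT : IsInvertibleRotation μ T} (γ : Path (mk S hS) (mk T hT)) :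
    ∃ R : I → W → W, (∀ θ, IsInvertibleRotation μ (R θ)) ∧ R 0 = S ∧ R 1 = T ∧
      ∀ θ, Tendsto (fun η => ∫⁻ w, ‖R η w - R θ w‖ₑ ∂μ) (𝓝 θ) (𝓝 0) := by
  have hrep : ∀ θ, ∃ R, ∃ hR : IsInvertibleRotation μ R,
      mk R hR = γ θ ∧ (θ = 0 → R = S) ∧ (θ = 1 → R = T) := fun θ => by
    by_cases h0 : θ = 0
    · exact ⟨S, hS, by simp [h0]⟩
    by_cases h1 : θ = 1
    · exact ⟨T, hT, by simp [h1]⟩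
    obtain ⟨R, hR, hRγ⟩ := exists_mk_eq (γ θ)
    exact ⟨R, hR, hRγ, fun h => absurd h h0, fun h => absurd h h1⟩
  choose R hR hRγ hR0 hR1 using hrep
  refine ⟨R, hR, hR0 0 rfl, hR1 1 rfl, fun θ => ?_⟩
  have hlim := tendsto_iff_edist_tendsto_0.1 (γ.continuous.tendsto θ)
  simpa only [← hRγ, edist_mk_mk] using hlim

end RotationGroup

theorem injOn_measure_singleton_of_isGaussian {E : Type*} [NormedAddCommGroup E] [NormedSpace ℝ E]
    [CompleteSpace E] [SecondCountableTopology E] [MeasurableSpace E] [BorelSpace E] (μ : Measure E)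
    [IsGaussian μ] : Set.InjOn (fun x => μ {x}) {x | μ {x} ≠ 0} := by
  by_cases hdirac : ∃ m, μ = Measure.dirac m
  · obtain ⟨m, rfl⟩ := hdirac
    have hm : ∀ x ∈ {x | Measure.dirac m {x} ≠ 0}, x = m := fun x hx => by
      by_contra hne
      exact hx (by simp [Ne.symm hne])
    exact fun x hx y hy _ => (hm x hx).trans (hm y hy).symm
  · have := IsGaussian.nullSingletonClass (not_exists.1 hdirac)
    exact fun x hx => absurd (measure_singleton x) hx

theorem IsAbstractWienerSpace.isGaussian {H W : Type*}
    [NormedAddCommGroup H] [InnerProductSpace ℝ H]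
    [NormedAddCommGroup W] [NormedSpace ℝ W] [MeasurableSpace W] [BorelSpace W]
    {i : H →L[ℝ] W} {μ : Measure W} (hμ : IsAbstractWienerSpace i μ) : IsGaussian μ :=
  isGaussian_of_map_eq_gaussianReal fun e => ⟨_, _, hμ.map_dual e⟩

theorem theorem6p1_general {W : Type*} [NormedAddCommGroup W] [SecondCountableTopology W]
    [MeasurableSpace W] [BorelSpace W] (μ : Measure W) [IsFiniteMeasure μ] (hμ : Integrable id μ)
    (hatom : Set.InjOn (fun w => μ {w}) {w | μ {w} ≠ 0}) :
    (∀ T : W → W, IsInvertibleRotation μ T →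
      ∃ R : I → W → W,
        (∀ θ : I, IsInvertibleRotation μ (R θ)) ∧ R 0 = id ∧ R 1 = T ∧
        ∀ θ : I, Tendsto (fun η : I => ∫⁻ w, ‖R η w - R θ w‖ₑ ∂μ) (𝓝 θ) (𝓝 0)) ∧
    PathConnectedSpace (RotationGroup μ) :=
  have hpath := RotationGroup.pathConnectedSpace hμ hatom
  ⟨fun T hT => RotationGroup.exists_representatives_of_path
    (hpath.somePath (RotationGroup.mk id (.refl_id μ)) (RotationGroup.mk T hT)), hpath⟩

theorem theorem6p1 {H W : Type*}
    [NormedAddCommGroup H] [InnerProductSpace ℝ H] [CompleteSpace H] [SecondCountableTopology H]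
    [NormedAddCommGroup W] [NormedSpace ℝ W] [CompleteSpace W] [SecondCountableTopology W]
    [MeasurableSpace W] [BorelSpace W]
    (i : H →L[ℝ] W) (μ : Measure W) (hμ : IsAbstractWienerSpace i μ) :
    (∀ T : W → W, IsInvertibleRotation μ T →
      ∃ R : I → W → W,
        (∀ θ : I, IsInvertibleRotation μ (R θ)) ∧ R 0 = id ∧ R 1 = T ∧
        ∀ θ : I, Tendsto (fun η : I => ∫⁻ w, ‖R η w - R θ w‖ₑ ∂μ) (𝓝 θ) (𝓝 0)) ∧
    ConnectedSpace (RotationGroup μ) := by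
  have := hμ.isGaussian
  exact (theorem6p1_general μ IsGaussian.integrable_id
    (injOn_measure_singleton_of_isGaussian μ)).imp_right fun h => h.connectedSpace
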